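/- Let $n, s, m$ be natural numbers, let $A_1,\dots,A_s \in \mathbb{R}^{n\times n}$, and let $\Gamma^{(1)},\dots,\Gamma^{(m)} \in \mathbb{R}^{s\times s}$ be row-stochastic matrices. Write $\mathcal{K} = \{1,\dots,s\}$, $\mathcal{S}_m = \{\alpha\in\mathbb{R}^m : \alpha_r \ge 0,\ \sum_{r=1}^m \alpha_r = 1\}$, and, for $\alpha \in \mathcal{S}_m$, $\Gamma(\alpha) = [t_{ij}(\alpha)] = \sum_{r=1}^m \alpha_r \Gamma^{(r)}$. Consider the Markov jump linear system (MJLS) $x_{k+1} = A_{\sigma_k} x_k$, where $(\sigma_k)_{k\ge 0}$ is a homogeneous Markov chain on $\mathcal{K}$ whose transition probability matrix $\Gamma$ is only known to lie in the polytope $\boldsymbol{\Gamma} = \{\Gamma(\alpha) : \alpha\in\mathcal{S}_m\}$. The MJLS is called robustly mean-square stable if $\lim_{k\to\infty} \mathbb{E}[x_k] = 0$ and $\lim_{k\to\infty}\mathbb{E}[\|x_k\|^2] = 0$ for all deterministic initial values $x_0\in\mathbb{R}^n$, $\sigma_0\in\mathcal{K}$ and all $\Gamma\in\boldsymbol{\Gamma}$.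 The MJLS is robustly mean-square stable if and only if there exist functions $X_i : \mathcal{S}_m \to \mathbb{R}^{n\times n}$, $i\in\mathcal{K}$, with symmetric positive definite values $X_i(\alpha) \succ 0$ such that $$\sum_{j\in\mathcal{K}} t_{ij}(\alpha)\, A_j^\top X_j(\alpha) A_j - X_i(\alpha) \prec 0 \qquad \text{for all } i\in\mathcal{K} \text{ and } \alpha\in\mathcal{S}_m.$$ -/

import Mathlib

open MeasureTheory Filter Topology

/-- `σ` is a homogeneous Markov chain with transition probability matrix `Γ` under `μ`: given any
history `h 0, …, h k`, the next mode is `j` with probability `Γ (h k) j`. The conditional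
probability is multiplied out, so that nothing is required at histories of probability zero. -/
structure IsMarkovChain {s : ℕ} {Ω : Type} [MeasurableSpace Ω] (μ : Measure Ω)
    (σ : ℕ → Ω → Fin s) (Γ : Matrix (Fin s) (Fin s) ℝ) : Prop where
  measurable : ∀ k, Measurable (σ k)
  markov : ∀ (k : ℕ) (h : ℕ → Fin s) (j : Fin s),
    μ.real {ω | (∀ l ≤ k, σ l ω = h l) ∧ σ (k + 1) ω = j} =
      μ.real {ω | ∀ l ≤ k, σ l ω = h l} * Γ (h k) j

/-- The state of the jump linear system `x (k + 1) = A (σ k) x k`, `x 0 = x₀`, along a mode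
sequence `σ`. -/
noncomputable def mjlsState {n s : ℕ} (A : Fin s → Matrix (Fin n) (Fin n) ℝ)
    (x₀ : EuclideanSpace ℝ (Fin n)) (σ : ℕ → Fin s) : ℕ → EuclideanSpace ℝ (Fin n)
  | 0 => x₀
  | k + 1 => Matrix.toEuclideanLin (A (σ k)) (mjlsState A x₀ σ k)

/-- The matrix `Γ(α) = ∑ r, α r • Γ r`. -/
def polytopicTPM {s m : ℕ} (Γ : Fin m → Matrix (Fin s) (Fin s) ℝ) (α : Fin m → ℝ) :
    Matrix (Fin s) (Fin s) ℝ :=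
  ∑ r, α r • Γ r

/-- The set of all `Γ(α)` with `α` in the unit simplex. -/
def tpmSet {s m : ℕ} (Γ : Fin m → Matrix (Fin s) (Fin s) ℝ) :
    Set (Matrix (Fin s) (Fin s) ℝ) :=
  {T | ∃ α ∈ stdSimplex ℝ (Fin m), T = polytopicTPM Γ α}

/-- Robust mean-square stability over a set `𝒯` of transition probability matrices: for all
deterministic initial states and initial modes, all `T ∈ 𝒯`, and every Markov chain with transition
probability matrix `T` started in the given mode, `E[x k] → 0` and `E[‖x k‖²] → 0`. -/
def RobustlyMeanSquareStable {n s : ℕ} (A : Fin s → Matrix (Fin n) (Fin n) ℝ)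
    (𝒯 : Set (Matrix (Fin s) (Fin s) ℝ)) : Prop :=
  ∀ (x₀ : EuclideanSpace ℝ (Fin n)) (s₀ : Fin s), ∀ T ∈ 𝒯,
    ∀ (Ω : Type) [MeasurableSpace Ω] (μ : Measure Ω) [IsProbabilityMeasure μ]
      (σ : ℕ → Ω → Fin s),
      IsMarkovChain μ σ T → (∀ᵐ ω ∂μ, σ 0 ω = s₀) →
        Tendsto (fun k => ∫ ω, mjlsState A x₀ (fun l => σ l ω) k ∂μ) atTop (𝓝 0) ∧
        Tendsto (fun k => ∫ ω, ‖mjlsState A x₀ (fun l => σ l ω) k‖ ^ 2 ∂μ) atTop (𝓝 0)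

/-! Write `L` for the positive linear operator `lyapunovOp`. The Markov property gives the duality
`E[x_{k+1}ᵀ X_{σ_k} x_{k+1}] = yᵀ (L^k X)_{s₀} y` with `y = A_{s₀} x₀`
(`IsMarkovChain.integral_euclideanForm`), so stability concerns the iterates of `L`.

If `L X ≺ X` with `X ≻ 0`, compactness of the sphere improves this to `L X ≤ ρ X` with `ρ < 1`
(`exists_lyapunovOp_le`). The expected Lyapunov function then decays geometrically, hence so does
the second moment, and Jensen's inequality handles the mean.

Conversely, a chain is constructed for each `Γ(α)` and each initial mode (`exists_isMarkovChain`).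
Stability forces `L^k 1 → 0`, so `L^N 1 ≺ 1` for some `N ≥ 1`, and `X = ∑_{k<N} L^k 1` telescopes to
`X - L X = 1 - L^N 1 ≻ 0` (`exists_posDef_of_tendsto`). -/

/-! ### Expectations along a Markov chain -/

theorem MeasureTheory.integral_comp_eq_sum {Ω S : Type*} [MeasurableSpace Ω] [MeasurableSpace S]
    [Fintype S] [MeasurableSingletonClass S] (μ : Measure Ω) [IsProbabilityMeasure μ]
    {Y : Ω → S} (hY : Measurable Y) (g : S → ℝ) :
    ∫ ω, g (Y ω) ∂μ = ∑ y, μ.real (Y ⁻¹' {y}) * g y := by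
  have : IsProbabilityMeasure (μ.map Y) := Measure.isProbabilityMeasure_map hY.aemeasurable
  rw [← integral_map hY.aemeasurable (f := g) (by fun_prop), integral_fintype .of_finite]
  refine Finset.sum_congr rfl fun y _ => ?_
  rw [map_measureReal_apply hY (measurableSet_singleton y), smul_eq_mul]

/-- The Markov property, for functionals of the history up to time `k` and of the next mode. -/
theorem IsMarkovChain.integral_succ {s : ℕ} {Ω : Type} [MeasurableSpace Ω] {μ : Measure Ω}
    [IsProbabilityMeasure μ] {σ : ℕ → Ω → Fin s} {T : Matrix (Fin s) (Fin s) ℝ}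
    (hσ : IsMarkovChain μ σ T) (k : ℕ) (g : (ℕ → Fin s) → Fin s → ℝ)
    (hg : ∀ h h' : ℕ → Fin s, (∀ l ≤ k, h l = h' l) → g h = g h') :
    ∫ ω, g (fun l => σ l ω) (σ (k + 1) ω) ∂μ =
      ∫ ω, ∑ j, T (σ k ω) j * g (fun l => σ l ω) j ∂μ := by
  let past : Ω → Fin (k + 1) → Fin s := fun ω l => σ l ω
  -- A finite past becomes an infinite history by freezing it after time `k`; functionals of the
  -- history up to `k` do not notice, so every expectation is a finite sum over pasts.
  let ext : (Fin (k + 1) → Fin s) → ℕ → Fin s := fun p l => p ⟨min l k, by omega⟩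
  have hpast : Measurable past := measurable_pi_lambda _ fun l => hσ.measurable l
  have hext : ∀ ω l, l ≤ k → σ l ω = ext (past ω) l := by
    intro ω l hl
    simp [past, ext, hl]
  have hgext : ∀ ω, g (fun l => σ l ω) = g (ext (past ω)) := fun ω => hg _ _ (hext ω)
  have hiff : ∀ ω p, past ω = p ↔ ∀ l ≤ k, σ l ω = ext p l := by
    intro ω p
    constructor
    · rintro rfl
      exact hext ω
    · intro h
      funext l
      have := h l (by omega)
      have hl : (⟨min (l : ℕ) k, by omega⟩ : Fin (k + 1)) = l := Fin.ext (by simp; omega)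
      simpa [past, ext, hl] using this
  have h1 : ∫ ω, g (fun l => σ l ω) (σ (k + 1) ω) ∂μ =
      ∑ y : (Fin (k + 1) → Fin s) × Fin s,
        μ.real ((fun ω => (past ω, σ (k + 1) ω)) ⁻¹' {y}) * g (ext y.1) y.2 := by
    rw [← integral_comp_eq_sum μ (hpast.prodMk (hσ.measurable _)) fun y => g (ext y.1) y.2]
    simp_rw [hgext]
  have h2 : ∫ ω, ∑ j, T (σ k ω) j * g (fun l => σ l ω) j ∂μ =
      ∑ p : Fin (k + 1) → Fin s, μ.real (past ⁻¹' {p}) * ∑ j, T (ext p k) j * g (ext p) j := by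
    rw [← integral_comp_eq_sum μ hpast fun p => ∑ j, T (ext p k) j * g (ext p) j]
    simp_rw [hgext, ← hext _ k le_rfl]
  rw [h1, h2, Fintype.sum_prod_type]
  refine Finset.sum_congr rfl fun p _ => ?_
  rw [Finset.mul_sum]
  refine Finset.sum_congr rfl fun j _ => ?_
  have e1 : (fun ω => (past ω, σ (k + 1) ω)) ⁻¹' {(p, j)} =
      {ω | (∀ l ≤ k, σ l ω = ext p l) ∧ σ (k + 1) ω = j} := by
    ext ω
    simp [hiff]
  have e2 : past ⁻¹' {p} = {ω | ∀ l ≤ k, σ l ω = ext p l} := by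
    ext ω
    simp [hiff]
  rw [e1, e2, hσ.markov, mul_assoc]

theorem mjlsState_congr {n s : ℕ} (A : Fin s → Matrix (Fin n) (Fin n) ℝ)
    (x₀ : EuclideanSpace ℝ (Fin n)) {σ τ : ℕ → Fin s} :
    ∀ {k : ℕ}, (∀ l < k, σ l = τ l) → mjlsState A x₀ σ k = mjlsState A x₀ τ k
  | 0, _ => rfl
  | k + 1, h => by
    rw [mjlsState, mjlsState, h k (by omega), mjlsState_congr A x₀ fun l hl => h l (by omega)]

/-- The integrand factors through the modes up to time `k`, which take finitely many values; hence
`f` may be arbitrary. -/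
theorem IsMarkovChain.integrable_mjlsState {E : Type*} [NormedAddCommGroup E] {n s : ℕ} {Ω : Type}
    [MeasurableSpace Ω] {μ : Measure Ω} [IsProbabilityMeasure μ] {σ : ℕ → Ω → Fin s}
    {T : Matrix (Fin s) (Fin s) ℝ} (hσ : IsMarkovChain μ σ T)
    (A : Fin s → Matrix (Fin n) (Fin n) ℝ) (x₀ : EuclideanSpace ℝ (Fin n)) (k : ℕ)
    (f : Fin s → EuclideanSpace ℝ (Fin n) → E) :
    Integrable (fun ω => f (σ k ω) (mjlsState A x₀ (fun l => σ l ω) k)) μ := by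
  let past : Ω → Fin (k + 1) → Fin s := fun ω l => σ l ω
  let ext : (Fin (k + 1) → Fin s) → ℕ → Fin s := fun p l => p ⟨min l k, by omega⟩
  have hpast : Measurable past := measurable_pi_lambda _ fun l => hσ.measurable l
  have hext : ∀ ω l, l ≤ k → σ l ω = ext (past ω) l := by
    intro ω l hl
    simp [past, ext, hl]
  have : IsProbabilityMeasure (μ.map past) := Measure.isProbabilityMeasure_map hpast.aemeasurable
  have hint : Integrable (fun p => f (ext p k) (mjlsState A x₀ (ext p) k)) (μ.map past) :=
    .of_finite
  refine (hint.comp_measurable hpast).congr (.of_forall fun ω => ?_)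
  simp only [Function.comp_apply]
  rw [hext ω k le_rfl, mjlsState_congr A x₀ fun l hl => hext ω l hl.le]

/-- The expectation of a mode-dependent functional `f` of the state, one step ahead. -/
theorem IsMarkovChain.integral_mjlsState_succ {n s : ℕ} {Ω : Type}
    [MeasurableSpace Ω] {μ : Measure Ω} [IsProbabilityMeasure μ] {σ : ℕ → Ω → Fin s}
    {T : Matrix (Fin s) (Fin s) ℝ} (hσ : IsMarkovChain μ σ T)
    (A : Fin s → Matrix (Fin n) (Fin n) ℝ) (x₀ : EuclideanSpace ℝ (Fin n)) (k : ℕ)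
    (f : Fin s → EuclideanSpace ℝ (Fin n) → ℝ) :
    ∫ ω, f (σ (k + 1) ω) (mjlsState A x₀ (fun l => σ l ω) (k + 2)) ∂μ =
      ∫ ω, ∑ j, T (σ k ω) j *
        f j (Matrix.toEuclideanLin (A j) (mjlsState A x₀ (fun l => σ l ω) (k + 1))) ∂μ :=
  hσ.integral_succ k
    (fun h j => f j (Matrix.toEuclideanLin (A j) (mjlsState A x₀ h (k + 1))))
    fun h h' hh => by
      funext j
      rw [mjlsState_congr A x₀ fun l hl => hh l (Nat.lt_succ_iff.1 hl)]

/-! ### Construction of a chain from independent random maps -/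

section Existence

/-- The mode sequence driven by the random maps `i ↦ u (k, i)`. -/
def drivenMode {s : ℕ} (s₀ : Fin s) (u : ℕ × Fin s → Fin s) : ℕ → Fin s
  | 0 => s₀
  | k + 1 => u (k, drivenMode s₀ u k)

/-- Following `h` consults only the coordinates `(l, h l)`, so a path event is a cylinder set of the
product space. -/
theorem drivenMode_eq_iff {s : ℕ} (s₀ : Fin s) (u : ℕ × Fin s → Fin s) (h : ℕ → Fin s) (k : ℕ) :
    (∀ l ≤ k, drivenMode s₀ u l = h l) ↔ s₀ = h 0 ∧ ∀ l < k, u (l, h l) = h (l + 1) := by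
  induction k with
  | zero => simp [drivenMode]
  | succ k ih =>
    constructor
    · intro H
      obtain ⟨h0, h1⟩ := ih.1 fun l hl => H l (by omega)
      refine ⟨h0, fun l hl => ?_⟩
      rw [← H (l + 1) (by omega), drivenMode, H l (by omega)]
    · rintro ⟨h0, h1⟩ l hl
      have H := ih.2 ⟨h0, fun l hl => h1 l (by omega)⟩
      rcases Nat.lt_or_ge k l with hk | hk
      · obtain rfl : l = k + 1 := by omega
        rw [drivenMode, H k le_rfl, h1 k (by omega)]
      · exact H l hk

theorem measurable_drivenMode {s : ℕ} (s₀ : Fin s) (k : ℕ) :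
    Measurable fun u : ℕ × Fin s → Fin s => drivenMode s₀ u k := by
  induction k with
  | zero => exact measurable_const
  | succ k ih =>
    have : Measurable fun p : (ℕ × Fin s → Fin s) × Fin s => p.1 (k, p.2) :=
      measurable_from_prod_countable_left fun j => measurable_pi_apply (k, j)
    exact this.comp (measurable_id.prodMk ih)

/-- A Markov chain with given row-stochastic transition matrix and given initial mode exists. -/
theorem exists_isMarkovChain {s : ℕ} {T : Matrix (Fin s) (Fin s) ℝ}
    (hT : T ∈ Matrix.rowStochastic ℝ (Fin s)) (s₀ : Fin s) :
    ∃ (μ : Measure (ℕ × Fin s → Fin s)) (σ : ℕ → (ℕ × Fin s → Fin s) → Fin s),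
      IsProbabilityMeasure μ ∧ IsMarkovChain μ σ T ∧ ∀ u, σ 0 u = s₀ := by
  have hnn : ∀ i j, 0 ≤ T i j := fun i j => Matrix.nonneg_of_mem_rowStochastic hT
  have hsum : ∀ i, ∑ j, ENNReal.ofReal (T i j) = 1 := fun i => by
    rw [← ENNReal.ofReal_sum_of_nonneg fun j _ => hnn i j,
      Matrix.sum_row_of_mem_rowStochastic hT, ENNReal.ofReal_one]
  -- Each pair (time, mode) gets an independent draw of the next mode, distributed as that mode's
  -- row of `T`.
  let ν : ℕ × Fin s → Measure (Fin s) := fun q =>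
    (PMF.ofFintype (fun j => ENNReal.ofReal (T q.2 j)) (hsum q.2)).toMeasure
  have hν : ∀ q j, (ν q).real {j} = T q.2 j := fun q j => by
    rw [Measure.real, PMF.toMeasure_apply_singleton _ _ (measurableSet_singleton j),
      PMF.ofFintype_apply, ENNReal.toReal_ofReal (hnn _ _)]
  have hpath : ∀ (h : ℕ → Fin s) (k : ℕ),
      (Measure.infinitePi ν).real {u | ∀ l ≤ k, drivenMode s₀ u l = h l} =
        if s₀ = h 0 then ∏ l ∈ Finset.range k, T (h l) (h (l + 1)) else 0 := by
    intro h k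
    simp_rw [drivenMode_eq_iff]
    split_ifs with h0
    -- The time component keeps the consulted coordinates distinct even when modes recur, so the
    -- product measure factorizes.
    · let e : ℕ ↪ ℕ × Fin s := ⟨fun l => (l, h l), fun a b hab => (Prod.ext_iff.1 hab).1⟩
      have hset : {u : ℕ × Fin s → Fin s | s₀ = h 0 ∧ ∀ l < k, u (l, h l) = h (l + 1)} =
          Set.pi ((Finset.range k).map e) fun q => {h (q.1 + 1)} := by
        ext u
        simp only [Set.mem_ofPred_eq, h0, true_and, Set.mem_pi, Finset.coe_map, Finset.coe_range,
          Set.forall_mem_image, Set.mem_Iio, Set.mem_singleton_iff]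
        rfl
      rw [hset, Measure.real, Measure.infinitePi_pi _ fun _ _ => measurableSet_singleton _,
        ENNReal.toReal_prod, Finset.prod_map]
      exact Finset.prod_congr rfl fun l _ => hν _ _
    · simp [h0]
  refine ⟨Measure.infinitePi ν, fun k u => drivenMode s₀ u k, inferInstance,
    ⟨measurable_drivenMode s₀, fun k h j => ?_⟩, fun u => rfl⟩
  -- Prescribing `j` at time `k + 1` turns the joint event into a path event one step longer.
  let h' : ℕ → Fin s := Function.update h (k + 1) j
  have hh' : ∀ l ≤ k, h' l = h l := fun l hl => Function.update_of_ne (by omega) _ _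
  have hset : {u | (∀ l ≤ k, drivenMode s₀ u l = h l) ∧ drivenMode s₀ u (k + 1) = j} =
      {u | ∀ l ≤ k + 1, drivenMode s₀ u l = h' l} := by
    ext u
    constructor
    · rintro ⟨H, rfl⟩ l hl
      rcases Nat.lt_or_ge k l with hk | hk
      · obtain rfl : l = k + 1 := by omega
        simp [h']
      · rw [hh' l hk, H l hk]
    · intro H
      refine ⟨fun l hl => ?_, ?_⟩
      · rw [H l (by omega), hh' l hl]
      · rw [H (k + 1) le_rfl]
        simp [h']
  rw [hset, hpath, hpath, hh' 0 (by omega), Finset.prod_range_succ, hh' k le_rfl]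
  have hj : h' (k + 1) = j := by simp [h']
  have hprod : ∏ l ∈ Finset.range k, T (h' l) (h' (l + 1)) =
      ∏ l ∈ Finset.range k, T (h l) (h (l + 1)) :=
    Finset.prod_congr rfl fun l hl => by
      rw [Finset.mem_range] at hl
      rw [hh' l (by omega), hh' (l + 1) (by omega)]
  rw [hj, hprod, ite_mul, zero_mul]

end Existence

/-! ### Quadratic forms of real matrices -/

namespace Matrix

variable {ι κ : Type*} [Fintype ι] [DecidableEq ι]

/-- The quadratic form `x ↦ xᵀ M x` on Euclidean space. -/
noncomputable def euclideanForm (M : Matrix ι ι ℝ) (x : EuclideanSpace ℝ ι) : ℝ :=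
  inner ℝ x (toEuclideanLin M x)

theorem euclideanForm_eq_dotProduct (M : Matrix ι ι ℝ) (x : EuclideanSpace ℝ ι) :
    euclideanForm M x = x.ofLp ⬝ᵥ (M *ᵥ x.ofLp) := by
  simp [euclideanForm, EuclideanSpace.inner_eq_star_dotProduct, toLpLin_apply, dotProduct_comm]

theorem euclideanForm_one (x : EuclideanSpace ℝ ι) : euclideanForm 1 x = ‖x‖ ^ 2 := by
  simp [euclideanForm]

theorem euclideanForm_sub (M N : Matrix ι ι ℝ) (x : EuclideanSpace ℝ ι) :
    euclideanForm (M - N) x = euclideanForm M x - euclideanForm N x := by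
  simp [euclideanForm, inner_sub_right]

theorem euclideanForm_neg (M : Matrix ι ι ℝ) (x : EuclideanSpace ℝ ι) :
    euclideanForm (-M) x = -euclideanForm M x := by
  simp [euclideanForm]

theorem euclideanForm_smul (c : ℝ) (M : Matrix ι ι ℝ) (x : EuclideanSpace ℝ ι) :
    euclideanForm (c • M) x = c * euclideanForm M x := by
  simp [euclideanForm, inner_smul_right]

theorem euclideanForm_sum (t : Finset κ) (M : κ → Matrix ι ι ℝ) (x : EuclideanSpace ℝ ι) :
    euclideanForm (∑ k ∈ t, M k) x = ∑ k ∈ t, euclideanForm (M k) x := by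
  simp [euclideanForm, inner_sum]

theorem euclideanForm_congruence (M A : Matrix ι ι ℝ) (x : EuclideanSpace ℝ ι) :
    euclideanForm (Aᵀ * M * A) x = euclideanForm M (toEuclideanLin A x) := by
  rw [euclideanForm_eq_dotProduct, euclideanForm_eq_dotProduct]
  simp [toLpLin_apply, dotProduct_mulVec, vecMul_transpose, ← mulVec_mulVec]

theorem posDef_iff_euclideanForm {M : Matrix ι ι ℝ} :
    M.PosDef ↔ M.IsHermitian ∧ ∀ x, x ≠ 0 → 0 < euclideanForm M x := by
  rw [posDef_iff_dotProduct_mulVec]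
  refine and_congr_right fun _ => ⟨fun h x hx => ?_, fun h x hx => ?_⟩
  · rw [euclideanForm_eq_dotProduct]
    exact h fun h0 => hx (WithLp.ofLp_injective 2 h0)
  · have := h (WithLp.toLp 2 x) fun h0 => hx (congrArg WithLp.ofLp h0)
    rwa [euclideanForm_eq_dotProduct] at this

open scoped Matrix.Norms.L2Operator in
theorem euclideanForm_le_norm_mul (M : Matrix ι ι ℝ) (x : EuclideanSpace ℝ ι) :
    euclideanForm M x ≤ ‖M‖ * ‖x‖ ^ 2 := by
  have h := l2_opNorm_mulVec M x
  calc euclideanForm M x ≤ ‖x‖ * ‖toEuclideanLin M x‖ := real_inner_le_norm _ _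
    _ ≤ ‖x‖ * (‖M‖ * ‖x‖) := by
      gcongr
      exact h
    _ = ‖M‖ * ‖x‖ ^ 2 := by ring

theorem exists_euclideanForm_le (M : Matrix ι ι ℝ) :
    ∃ C, 0 < C ∧ ∀ x, euclideanForm M x ≤ C * ‖x‖ ^ 2 := by
  open scoped Matrix.Norms.L2Operator in
  exact ⟨‖M‖ + 1, by positivity, fun x => (euclideanForm_le_norm_mul M x).trans (by
    gcongr
    linarith)⟩

/-- A positive definite form dominates a positive multiple of the squared norm. -/
theorem PosDef.exists_le_euclideanForm {M : Matrix ι ι ℝ} (hM : M.PosDef) :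
    ∃ c, 0 < c ∧ ∀ x, c * ‖x‖ ^ 2 ≤ euclideanForm M x := by
  have hcont : Continuous fun x : EuclideanSpace ℝ ι => euclideanForm M x := by
    unfold euclideanForm
    have := (toEuclideanLin M).continuous_of_finiteDimensional
    fun_prop
  rcases (Metric.sphere (0 : EuclideanSpace ℝ ι) 1).eq_empty_or_nonempty with he | hne
  -- An empty unit sphere means that the space is zero.
  · refine ⟨1, one_pos, fun x => ?_⟩
    have hx : x = 0 := by
      by_contra hx
      have : (‖x‖⁻¹ : ℝ) • x ∈ Metric.sphere (0 : EuclideanSpace ℝ ι) 1 := by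
        simp [norm_smul, hx]
      simp [he] at this
    simp [hx, euclideanForm]
  · obtain ⟨y, hy, hmin⟩ := (isCompact_sphere (0 : EuclideanSpace ℝ ι) 1).exists_isMinOn hne
      hcont.continuousOn
    have hy0 : y ≠ 0 := by
      rintro rfl
      simp at hy
    refine ⟨euclideanForm M y, (posDef_iff_euclideanForm.1 hM).2 y hy0, fun x => ?_⟩
    by_cases hx : x = 0
    · simp [hx, euclideanForm]
    have h1 : euclideanForm M y ≤ euclideanForm M ((‖x‖⁻¹ : ℝ) • x) :=
      hmin (by simp [norm_smul, hx])
    have h2 : euclideanForm M ((‖x‖⁻¹ : ℝ) • x) = euclideanForm M x / ‖x‖ ^ 2 := by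
      simp only [euclideanForm, map_smul, real_inner_smul_left, real_inner_smul_right]
      field_simp
    have hpos : 0 < ‖x‖ ^ 2 := by positivity
    rwa [h2, le_div_iff₀ hpos] at h1

/-- Symmetric matrices whose forms tend to zero pointwise are eventually dominated by the
identity. -/
theorem eventually_posDef_one_sub {M : ℕ → Matrix ι ι ℝ} (hM : ∀ k, (M k).IsHermitian)
    (hlim : ∀ x, Tendsto (fun k => euclideanForm (M k) x) atTop (𝓝 0)) :
    ∀ᶠ k in atTop, (1 - M k).PosDef := by
  open scoped Matrix.Norms.L2Operator in
  -- Polarization on basis vectors: by symmetry the form determines the entries, so pointwise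
  -- convergence of forms gives norm convergence.
  have hpol : ∀ k i j, M k i j = (euclideanForm (M k) (.single i 1 + .single j 1) -
      euclideanForm (M k) (.single i 1) - euclideanForm (M k) (.single j 1)) / 2 := by
    intro k i j
    have hs : M k j i = M k i j := by simpa using (hM k).apply i j
    simp only [euclideanForm_eq_dotProduct, WithLp.ofLp_add, PiLp.ofLp_single, mulVec_add,
      mulVec_single_one, add_dotProduct, dotProduct_add, single_one_dotProduct, col_apply, hs]
    ring
  have hzero : Tendsto M atTop (𝓝 0) := by
    refine tendsto_pi_nhds.2 fun i => tendsto_pi_nhds.2 fun j => ?_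
    simp_rw [hpol]
    simpa using (((hlim (.single i 1 + .single j 1)).sub (hlim (.single i 1))).sub
      (hlim (.single j 1))).div_const 2
  have hnorm : ∀ᶠ k in atTop, ‖M k‖ < 1 := by
    have := hzero.norm
    rw [norm_zero] at this
    exact this.eventually_lt_const one_pos
  filter_upwards [hnorm] with k hk
  refine posDef_iff_euclideanForm.2 ⟨isHermitian_one.sub (hM k), fun x hx => ?_⟩
  rw [euclideanForm_sub, euclideanForm_one]
  have hx' : 0 < ‖x‖ ^ 2 := by positivity
  nlinarith [euclideanForm_le_norm_mul (M k) x]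

end Matrix

open Matrix

/-! ### Coupled Lyapunov inequalities and second moments -/

section Stability

variable {n s : ℕ} (A : Fin s → Matrix (Fin n) (Fin n) ℝ) (T : Matrix (Fin s) (Fin s) ℝ)

/-- The coupled Lyapunov operator `X ↦ (∑ j, T i j • (A j)ᵀ * X j * A j)ᵢ`. -/
noncomputable def lyapunovOp (X : Fin s → Matrix (Fin n) (Fin n) ℝ) :
    Fin s → Matrix (Fin n) (Fin n) ℝ :=
  fun i => ∑ j, T i j • ((A j)ᵀ * X j * A j)

theorem euclideanForm_lyapunovOp (X : Fin s → Matrix (Fin n) (Fin n) ℝ) (i : Fin s)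
    (x : EuclideanSpace ℝ (Fin n)) :
    euclideanForm (lyapunovOp A T X i) x =
      ∑ j, T i j * euclideanForm (X j) (toEuclideanLin (A j) x) := by
  simp_rw [lyapunovOp, euclideanForm_sum, euclideanForm_smul, euclideanForm_congruence]

theorem isHermitian_lyapunovOp {X : Fin s → Matrix (Fin n) (Fin n) ℝ}
    (hX : ∀ i, (X i).IsHermitian) (i : Fin s) : (lyapunovOp A T X i).IsHermitian := by
  rw [IsHermitian, lyapunovOp, conjTranspose_sum]
  refine Finset.sum_congr rfl fun j _ => ?_
  have := (hX j).eq
  rw [conjTranspose_eq_transpose_of_trivial] at this ⊢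
  simp [transpose_mul, this, Matrix.mul_assoc]

theorem lyapunovOp_sum {κ : Type*} (t : Finset κ) (X : κ → Fin s → Matrix (Fin n) (Fin n) ℝ)
    (i : Fin s) :
    lyapunovOp A T (fun j => ∑ k ∈ t, X k j) i = ∑ k ∈ t, lyapunovOp A T (X k) i := by
  simp only [lyapunovOp, Finset.mul_sum, Finset.sum_mul, Finset.smul_sum]
  exact Finset.sum_comm

variable {A T} {Ω : Type} [MeasurableSpace Ω] {μ : Measure Ω} [IsProbabilityMeasure μ]
  {σ : ℕ → Ω → Fin s}

/-- The mode at time `k` is paired with the state at time `k + 1` because the operator uses the next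
mode `j` both in `A j` and in `X j`. -/
theorem IsMarkovChain.integral_euclideanForm_succ (hσ : IsMarkovChain μ σ T)
    (x₀ : EuclideanSpace ℝ (Fin n)) (X : Fin s → Matrix (Fin n) (Fin n) ℝ) (k : ℕ) :
    ∫ ω, euclideanForm (X (σ (k + 1) ω)) (mjlsState A x₀ (fun l => σ l ω) (k + 2)) ∂μ =
      ∫ ω, euclideanForm (lyapunovOp A T X (σ k ω))
        (mjlsState A x₀ (fun l => σ l ω) (k + 1)) ∂μ := by
  simp_rw [euclideanForm_lyapunovOp]
  exact hσ.integral_mjlsState_succ A x₀ k fun i => euclideanForm (X i)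

theorem IsMarkovChain.integral_euclideanForm (hσ : IsMarkovChain μ σ T) {s₀ : Fin s}
    (h₀ : ∀ᵐ ω ∂μ, σ 0 ω = s₀) (x₀ : EuclideanSpace ℝ (Fin n)) (k : ℕ) :
    ∀ X : Fin s → Matrix (Fin n) (Fin n) ℝ,
    ∫ ω, euclideanForm (X (σ k ω)) (mjlsState A x₀ (fun l => σ l ω) (k + 1)) ∂μ =
      euclideanForm ((lyapunovOp A T)^[k] X s₀) (toEuclideanLin (A s₀) x₀) := by
  induction k with
  | zero =>
    intro X
    rw [integral_congr_ae (g := fun _ => euclideanForm (X s₀) (toEuclideanLin (A s₀) x₀))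
      (by filter_upwards [h₀] with ω hω; simp [mjlsState, hω])]
    simp
  | succ k ih =>
    intro X
    rw [hσ.integral_euclideanForm_succ, ih, Function.iterate_succ_apply]

/-- Convergence to zero of the second moment forces that of the first. -/
theorem tendsto_integral_mjlsState_of_sq (hσ : IsMarkovChain μ σ T)
    (x₀ : EuclideanSpace ℝ (Fin n))
    (h : Tendsto (fun k => ∫ ω, ‖mjlsState A x₀ (fun l => σ l ω) k‖ ^ 2 ∂μ) atTop (𝓝 0)) :
    Tendsto (fun k => ∫ ω, mjlsState A x₀ (fun l => σ l ω) k ∂μ) atTop (𝓝 0) := by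
  have hsq : Tendsto (fun k => ‖∫ ω, mjlsState A x₀ (fun l => σ l ω) k ∂μ‖ ^ 2) atTop (𝓝 0) := by
    refine squeeze_zero (fun _ => by positivity) (fun k => ?_) h
    exact (convexOn_univ_norm.pow (fun _ _ => norm_nonneg _) 2).map_integral_le
      (by fun_prop) isClosed_univ (.of_forall fun _ => Set.mem_univ _)
      (hσ.integrable_mjlsState A x₀ k fun _ x => x)
      (hσ.integrable_mjlsState A x₀ k fun _ x => ‖x‖ ^ 2)
  rw [tendsto_zero_iff_norm_tendsto_zero]
  simpa using hsq.sqrt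

/-- A strict solution of the coupled Lyapunov inequalities is a strict contraction for the
Lyapunov operator. -/
theorem exists_lyapunovOp_le {X : Fin s → Matrix (Fin n) (Fin n) ℝ}
    (hX : ∀ i, (X i).PosDef) (hLX : ∀ i, (-(lyapunovOp A T X i - X i)).PosDef) :
    ∃ ρ, 0 ≤ ρ ∧ ρ < 1 ∧ ∀ i x,
      euclideanForm (lyapunovOp A T X i) x ≤ ρ * euclideanForm (X i) x := by
  have hnn : ∀ i x, 0 ≤ euclideanForm (X i) x := fun i x => by
    obtain ⟨c, hc, h⟩ := (hX i).exists_le_euclideanForm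
    exact le_trans (by positivity) (h x)
  have key : ∀ i, ∃ ε, 0 < ε ∧ ε ≤ 1 ∧ ∀ x,
      euclideanForm (lyapunovOp A T X i) x ≤ (1 - ε) * euclideanForm (X i) x := by
    intro i
    obtain ⟨c, hc, hlow⟩ := (hLX i).exists_le_euclideanForm
    obtain ⟨C, hC, hup⟩ := exists_euclideanForm_le (X i)
    -- From `c‖x‖² ≤ X - L X` and `X ≤ C‖x‖²`, the drop is at least the fraction `c / C` of `X`;
    -- capping at 1 keeps the contraction factor nonnegative.
    refine ⟨min (c / C) 1, by positivity, min_le_right _ _, fun x => ?_⟩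
    have h1 := hlow x
    rw [euclideanForm_neg, euclideanForm_sub] at h1
    have h2 : min (c / C) 1 * euclideanForm (X i) x ≤ c / C * (C * ‖x‖ ^ 2) :=
      mul_le_mul (min_le_left _ _) (hup x) (hnn i x) (by positivity)
    have h3 : c / C * (C * ‖x‖ ^ 2) = c * ‖x‖ ^ 2 := by field_simp
    linarith
  choose ε hε0 hε1 hε using key
  rcases isEmpty_or_nonempty (Fin s) with he | hne
  · exact ⟨0, le_rfl, one_pos, fun i => he.elim i⟩
  · obtain ⟨i₀, hi₀⟩ := Finite.exists_min ε
    refine ⟨1 - ε i₀, by linarith [hε1 i₀], by linarith [hε0 i₀], fun i x => (hε i x).trans ?_⟩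
    exact mul_le_mul_of_nonneg_right (by linarith [hi₀ i]) (hnn i x)

/-- The expected Lyapunov function `V` shrinks by `ρ` per step and, up to a constant uniform over
the finitely many modes, bounds the second moment. -/
theorem tendsto_integral_sq_of_lyapunov {X : Fin s → Matrix (Fin n) (Fin n) ℝ}
    (hX : ∀ i, (X i).PosDef) (hLX : ∀ i, (-(lyapunovOp A T X i - X i)).PosDef)
    (hσ : IsMarkovChain μ σ T) (x₀ : EuclideanSpace ℝ (Fin n)) :
    Tendsto (fun k => ∫ ω, ‖mjlsState A x₀ (fun l => σ l ω) k‖ ^ 2 ∂μ) atTop (𝓝 0) := by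
  obtain ⟨ρ, hρ0, hρ1, hρ⟩ := exists_lyapunovOp_le hX hLX
  choose c hc hcX using fun i => (hX i).exists_le_euclideanForm
  let V : ℕ → ℝ := fun k =>
    ∫ ω, euclideanForm (X (σ k ω)) (mjlsState A x₀ (fun l => σ l ω) (k + 1)) ∂μ
  have hV : ∀ k, V k ≤ ρ ^ k * V 0 := by
    intro k
    induction k with
    | zero => simp
    | succ k ih =>
      have hstep : V (k + 1) ≤ ρ * V k := by
        simp only [V]
        rw [hσ.integral_euclideanForm_succ, ← integral_const_mul]
        exact integral_mono
          (hσ.integrable_mjlsState A x₀ k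
            fun i x => euclideanForm (lyapunovOp A T X i) (toEuclideanLin (A i) x))
          ((hσ.integrable_mjlsState A x₀ k
            fun i x => euclideanForm (X i) (toEuclideanLin (A i) x)).const_mul ρ)
          fun ω => hρ _ _
      calc V (k + 1) ≤ ρ * V k := hstep
        _ ≤ ρ * (ρ ^ k * V 0) := by gcongr
        _ = ρ ^ (k + 1) * V 0 := by ring
  obtain ⟨c', hc', hcc⟩ : ∃ c', 0 < c' ∧ ∀ i, c' ≤ c i := by
    rcases isEmpty_or_nonempty (Fin s) with he | hne
    · exact ⟨1, one_pos, fun i => he.elim i⟩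
    · obtain ⟨i₀, hi₀⟩ := Finite.exists_min c
      exact ⟨c i₀, hc i₀, hi₀⟩
  rw [← tendsto_add_atTop_iff_nat 1]
  refine squeeze_zero (fun k => integral_nonneg fun ω => by positivity) (fun k => ?_)
    (g := fun k => c'⁻¹ * (ρ ^ k * V 0)) ?_
  · have h1 : c' * ∫ ω, ‖mjlsState A x₀ (fun l => σ l ω) (k + 1)‖ ^ 2 ∂μ ≤ V k := by
      rw [← integral_const_mul]
      exact integral_mono ((hσ.integrable_mjlsState A x₀ (k + 1) fun _ x => ‖x‖ ^ 2).const_mul c')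
        (hσ.integrable_mjlsState A x₀ k
            fun i x => euclideanForm (X i) (toEuclideanLin (A i) x))
        fun ω => (mul_le_mul_of_nonneg_right (hcc _) (by positivity)).trans (hcX _ _)
    rw [le_inv_mul_iff₀ hc']
    exact h1.trans (hV k)
  · simpa using ((tendsto_pow_atTop_nhds_zero_of_lt_one hρ0 hρ1).mul_const (V 0)).const_mul c'⁻¹

/-- If the second moments vanish asymptotically for all initial data, then the coupled Lyapunov
inequalities are strictly solvable: a truncated sum of the iterates of the identity works. -/
theorem exists_posDef_of_tendsto
    (h : ∀ (j : Fin s) (x : EuclideanSpace ℝ (Fin n)), Tendsto (fun k =>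
      euclideanForm ((lyapunovOp A T)^[k] (fun _ => 1) j) (toEuclideanLin (A j) x)) atTop (𝓝 0))
    (hT : ∀ i j, 0 ≤ T i j) :
    ∃ X : Fin s → Matrix (Fin n) (Fin n) ℝ,
      ∀ i, (X i).PosDef ∧ (-(lyapunovOp A T X i - X i)).PosDef := by
  let M : ℕ → Fin s → Matrix (Fin n) (Fin n) ℝ := fun k => (lyapunovOp A T)^[k] fun _ => 1
  have hMs : ∀ k, M (k + 1) = lyapunovOp A T (M k) := fun k => Function.iterate_succ_apply' _ _ _
  have hherm : ∀ k i, (M k i).IsHermitian := by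
    intro k
    induction k with
    | zero => exact fun _ => isHermitian_one
    | succ k ih =>
      rw [hMs]
      exact isHermitian_lyapunovOp A T ih
  have hnn : ∀ k i x, 0 ≤ euclideanForm (M k i) x := by
    intro k
    induction k with
    | zero =>
      intro i x
      simp only [M, Function.iterate_zero, id_eq, euclideanForm_one]
      positivity
    | succ k ih =>
      intro i x
      rw [hMs, euclideanForm_lyapunovOp]
      exact Finset.sum_nonneg fun j _ => mul_nonneg (hT i j) (ih _ _)
  have hlim : ∀ i x, Tendsto (fun k => euclideanForm (M k i) x) atTop (𝓝 0) := by
    intro i x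
    -- The hypothesis only sees vectors in the ranges of the `A j`; one more application of the
    -- operator evaluates the forms exactly there, giving convergence at every `x`.
    rw [← tendsto_add_atTop_iff_nat 1]
    simp_rw [hMs, euclideanForm_lyapunovOp]
    simpa using tendsto_finsetSum Finset.univ fun j _ => (h j x).const_mul (T i j)
  -- `N ≥ 1` puts the identity into the truncated sum, which makes it positive definite.
  obtain ⟨N, hN, hN1⟩ := ((eventually_all.2 fun i =>
    eventually_posDef_one_sub (fun k => hherm k i) (hlim i)).and (eventually_ge_atTop 1)).exists
  refine ⟨fun i => ∑ k ∈ Finset.range N, M k i, fun i => ⟨?_, ?_⟩⟩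
  · refine posDef_iff_euclideanForm.2 ⟨?_, fun x hx => ?_⟩
    · rw [IsHermitian, conjTranspose_sum]
      exact Finset.sum_congr rfl fun k _ => (hherm k i).eq
    · rw [euclideanForm_sum]
      refine Finset.sum_pos' (fun k _ => hnn k i x) ⟨0, Finset.mem_range.2 hN1, ?_⟩
      simp only [M, Function.iterate_zero, id_eq, euclideanForm_one]
      positivity
  · have : -(lyapunovOp A T (fun j => ∑ k ∈ Finset.range N, M k j) i -
        ∑ k ∈ Finset.range N, M k i) = 1 - M N i := by
      rw [lyapunovOp_sum, ← Finset.sum_sub_distrib]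
      simp_rw [← hMs]
      rw [Finset.sum_range_sub fun k => M k i, neg_sub]
      rfl
    rw [this]
    exact hN i

end Stability

/-! ### Robust stability over the polytope -/

theorem polytopicTPM_mem_rowStochastic {s m : ℕ} {Γ : Fin m → Matrix (Fin s) (Fin s) ℝ}
    (hΓ : ∀ r, Γ r ∈ Matrix.rowStochastic ℝ (Fin s)) {α : Fin m → ℝ}
    (hα : α ∈ stdSimplex ℝ (Fin m)) :
    polytopicTPM Γ α ∈ Matrix.rowStochastic ℝ (Fin s) :=
  convex_rowStochastic.sum_mem (fun r _ => hα.1 r) hα.2 fun r _ => hΓ r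

theorem theorem1 {n s m : ℕ} (A : Fin s → Matrix (Fin n) (Fin n) ℝ)
    (Γ : Fin m → Matrix (Fin s) (Fin s) ℝ)
    (hΓ : ∀ r, Γ r ∈ Matrix.rowStochastic ℝ (Fin s)) :
    RobustlyMeanSquareStable A (tpmSet Γ) ↔
      ∃ X : Fin s → stdSimplex ℝ (Fin m) → Matrix (Fin n) (Fin n) ℝ,
        ∀ (i : Fin s) (α : stdSimplex ℝ (Fin m)),
          (X i α).PosDef ∧
          (-((∑ j, polytopicTPM Γ α i j • ((A j).transpose * X j α * A j)) - X i α)).PosDef := by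
  constructor
  · intro hstab
    -- No regularity in `α` is demanded of `X`, so each `α` is treated separately and the solutions
    -- are chosen pointwise.
    have key : ∀ α : stdSimplex ℝ (Fin m), ∃ X : Fin s → Matrix (Fin n) (Fin n) ℝ, ∀ i,
        (X i).PosDef ∧ (-(lyapunovOp A (polytopicTPM Γ α) X i - X i)).PosDef := by
      intro α
      have hT := polytopicTPM_mem_rowStochastic hΓ α.2
      refine exists_posDef_of_tendsto (fun j x => ?_)
        fun i j => Matrix.nonneg_of_mem_rowStochastic hT
      obtain ⟨μ, σ, hμ, hσ, h₀⟩ := exists_isMarkovChain hT j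
      have h₀' : ∀ᵐ ω ∂μ, σ 0 ω = j := .of_forall h₀
      have h2 := (hstab x j _ ⟨α, α.2, rfl⟩ _ μ σ hσ h₀').2
      rw [← tendsto_add_atTop_iff_nat 1] at h2
      refine h2.congr fun k => ?_
      refine Eq.trans ?_ (hσ.integral_euclideanForm h₀' x k fun _ => 1)
      simp_rw [euclideanForm_one]
    choose X hX using key
    exact ⟨fun i α => X α i, fun i α => hX α i⟩
  · rintro ⟨X, hX⟩ x₀ s₀ T ⟨α, hα, rfl⟩ Ω _ μ _ σ hσ _
    have hsq := tendsto_integral_sq_of_lyapunov (X := fun i => X i ⟨α, hα⟩)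
      (fun i => (hX i ⟨α, hα⟩).1) (fun i => (hX i ⟨α, hα⟩).2) hσ x₀
    exact ⟨tendsto_integral_mjlsState_of_sq hσ x₀ hsq, hsq⟩
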